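/- Let $\mathcal H$ be a separable complex Hilbert space and let $A$ be a (possibly unbounded) self-adjoint operator on $\mathcal H$ with domain $D(A)$. Then $\pm iI+A : D(A)\to\mathcal H$ are bijective, and the resolvents $R_{\pm i}=(\pm iI+A)^{-1}$ are bounded normal operators on $\mathcal H$ satisfying $R_{\pm i}^{*}=R_{\mp i}$. Moreover, there exist a finite measure space $(Y,\mu)$, a unitary operator $U:\mathcal H\to L^{2}(Y,\mu)$ and a bounded measurable function $F:Y\to\mathbb C$, nonzero $\mu$-almost everywhere, such that $$U R_{i} U^{-1}=M_F,$$ where $M_F$ denotes the operator of multiplication by $F$, $M_F\varphi=F\varphi$, with domain $D(M_F)=\{\varphi\in L^{2}(Y,\mu) : F\varphi\in L^{2}(Y,\mu)\}$ (equal to $L^2(Y,\mu)$ here). -/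

import Mathlib

open MeasureTheory
open scoped ENNReal

noncomputable section

namespace Resolvante

/-- The operator `z I + A`, with domain the domain of `A`. -/
def scalarAdd {H : Type*} [NormedAddCommGroup H] [InnerProductSpace ℂ H]
    (z : ℂ) (A : H →ₗ.[ℂ] H) : H →ₗ.[ℂ] H :=
  (z • LinearMap.id : H →ₗ[ℂ] H) +ᵥ A

/-- The everywhere defined bounded operator `R` is the inverse of the (unbounded) operator `T`:
`R` maps into the domain of `T`, `T R u = u` for every `u`, and `R T v = v` for every `v` in the
domain of `T`. -/
def IsBoundedInverse {H : Type*} [NormedAddCommGroup H] [InnerProductSpace ℂ H]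
    (T : H →ₗ.[ℂ] H) (R : H →L[ℂ] H) : Prop :=
  (∀ u : H, ∃ h : R u ∈ T.domain, T ⟨R u, h⟩ = u) ∧ ∀ v : T.domain, R (T v) = (v : H)

/-- The operator of multiplication by `F` in `L²(Y, μ)`, with domain
`{φ ∈ L² | F φ ∈ L²}`, sending `φ` to `F φ`. -/
def mulOp {Y : Type*} [MeasurableSpace Y] (μ : Measure Y) (F : Y → ℂ) :
    Lp ℂ 2 μ →ₗ.[ℂ] Lp ℂ 2 μ where
  domain :=
    { carrier := {φ | MemLp (fun y => F y * φ y) 2 μ}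
      zero_mem' := by
        refine (MemLp.zero : MemLp (0 : Y → ℂ) 2 μ).ae_eq ?_
        filter_upwards [Lp.coeFn_zero ℂ 2 μ] with y hy
        change (0 : ℂ) = F y * (0 : Lp ℂ 2 μ) y
        rw [hy, Pi.zero_apply, mul_zero]
      add_mem' := by
        intro φ ψ hφ hψ
        refine (MemLp.add hφ hψ).ae_eq ?_
        filter_upwards [Lp.coeFn_add φ ψ] with y hy
        change F y * φ y + F y * ψ y = F y * (φ + ψ : Lp ℂ 2 μ) y
        rw [hy, Pi.add_apply, mul_add]
      smul_mem' := by
        intro c φ hφ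
        refine (MemLp.const_smul hφ c).ae_eq ?_
        filter_upwards [Lp.coeFn_smul c φ] with y hy
        simp [hy, mul_left_comm] }
  toFun :=
    { toFun := fun φ => MemLp.toLp (fun y => F y * (φ : Lp ℂ 2 μ) y) φ.2
      map_add' := by
        intro φ ψ
        rw [← MemLp.toLp_add]
        refine MemLp.toLp_congr _ _ ?_
        filter_upwards [Lp.coeFn_add (φ : Lp ℂ 2 μ) (ψ : Lp ℂ 2 μ)] with y hy
        change F y * (φ + ψ : Lp ℂ 2 μ) y = F y * (φ : Lp ℂ 2 μ) y + F y * (ψ : Lp ℂ 2 μ) y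
        rw [hy, Pi.add_apply, mul_add]
      map_smul' := by
        intro c φ
        rw [RingHom.id_apply, ← MemLp.toLp_const_smul]
        refine MemLp.toLp_congr _ _ ?_
        filter_upwards [Lp.coeFn_smul c (φ : Lp ℂ 2 μ)] with y hy
        simp [hy, mul_left_comm] }

end Resolvante

end

noncomputable section

namespace Resolvante

/-! ### Resolvents of a self-adjoint operator off the real axis. -/

section Resolvent

variable {H : Type*} [NormedAddCommGroup H] [InnerProductSpace ℂ H]

/-! Since `⟨v, A v⟩` is real, `‖(z + A) v‖ ≥ |Im z| ‖v‖`. As the graph of `A` is closed, the range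
of `z + A` is then closed, and self-adjointness kills its orthogonal complement. So resolvents exist
for nonreal `z`; the adjoint of one is the one at the conjugate point, and the resolvent identity
makes the two commute, so each is normal.

A normal `R` on a separable space is diagonalized through its continuous functional calculus, a
representation of `C(σ(R), ℂ)`. Gram–Schmidt on a total sequence splits `H` into countably many
orthogonal cyclic subspaces; Riesz–Markov gives each generator a finite spectral measure. Orbit
vectors in `H` and continuous functions on the slices of `ℕ × σ(R)` have the same Gram matrix and
are both total, which yields the unitary (`exists_diagonalization`). The function representing `R`
vanishes almost nowhere because a resolvent is injective. -/

theorem scalarAdd_apply (z : ℂ) (A : H →ₗ.[ℂ] H) (v : A.domain) :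
    scalarAdd z A v = z • (v : H) + A v := rfl

/-- The map `(x, y) ↦ z x + y` on the graph of `A`. -/
def graphMap (z : ℂ) (A : H →ₗ.[ℂ] H) : A.graph →L[ℂ] H :=
  (z • ContinuousLinearMap.fst ℂ H H + ContinuousLinearMap.snd ℂ H H) ∘L A.graph.subtypeL

theorem graphMap_apply (z : ℂ) (A : H →ₗ.[ℂ] H) (p : A.graph) :
    graphMap z A p = z • (p : H × H).1 + (p : H × H).2 := rfl

theorem IsBoundedInverse.injective {T : H →ₗ.[ℂ] H} {R : H →L[ℂ] H} (h : IsBoundedInverse T R) :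
    Function.Injective R := by
  intro u v huv
  obtain ⟨hu, hu'⟩ := h.1 u
  obtain ⟨hv, hv'⟩ := h.1 v
  rw [← hu', ← hv']
  congr 1
  exact Subtype.ext huv

variable {A : H →ₗ.[ℂ] H}

theorem resolvent_sub {z w : ℂ} {R S : H →L[ℂ] H} (hR : IsBoundedInverse (scalarAdd z A) R)
    (hS : IsBoundedInverse (scalarAdd w A) S) (u : H) : R u - S u = (w - z) • R (S u) := by
  obtain ⟨hs, hs'⟩ := hS.1 u
  have h1 := hR.2 ⟨S u, hs⟩
  have h2 : scalarAdd w A ⟨S u, hs⟩ =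
      (w - z) • S u + scalarAdd z A ⟨S u, hs⟩ := by
    change w • S u + A ⟨S u, _⟩ = (w - z) • S u + (z • S u + A ⟨S u, _⟩)
    module
  have h3 : scalarAdd z A ⟨S u, hs⟩ = u - (w - z) • S u :=
    eq_sub_of_add_eq' (h2.symm.trans hs')
  have h4 : R u - (w - z) • R (S u) = S u := by
    rw [← map_smul, ← map_sub, ← h3]
    exact h1
  rw [sub_eq_iff_eq_add, ← sub_eq_iff_eq_add']
  exact h4

theorem commute_resolvent {z w : ℂ} (hzw : z ≠ w) {R S : H →L[ℂ] H}
    (hR : IsBoundedInverse (scalarAdd z A) R) (hS : IsBoundedInverse (scalarAdd w A) S) :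
    Commute R S := by
  ext u
  have h1 := resolvent_sub hR hS u
  have h2 := resolvent_sub hS hR u
  have h3 : (w - z) • R (S u) = (w - z) • S (R u) := by
    rw [← h1, ← neg_sub z w, neg_smul, ← h2]
    abel
  exact smul_right_injective H (sub_ne_zero.mpr hzw.symm) h3

variable [CompleteSpace H]

theorem inner_apply_eq_of_isSelfAdjoint (hA : IsSelfAdjoint A) (v w : A.domain) :
    inner ℂ (A v) (w : H) = inner ℂ (v : H) (A w) := by
  have h := LinearPMap.adjoint_isFormalAdjoint hA.dense_domain
  rw [LinearPMap.isSelfAdjoint_def.mp hA] at h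
  exact h v w

/-- As `⟨v, A v⟩` is real, `⟨v, (z + A) v⟩` has imaginary part `Im z ‖v‖²`; conclude by
Cauchy–Schwarz. -/
theorem abs_im_mul_norm_le (hA : IsSelfAdjoint A) (z : ℂ) (v : A.domain) :
    |z.im| * ‖(v : H)‖ ≤ ‖z • (v : H) + A v‖ := by
  have hreal : (inner ℂ (v : H) (A v)).im = 0 := by
    have h := inner_apply_eq_of_isSelfAdjoint hA v v
    rw [← inner_conj_symm] at h
    exact Complex.conj_eq_iff_im.mp h
  have him : (inner ℂ (v : H) (z • (v : H) + A v)).im = z.im * ‖(v : H)‖ ^ 2 := by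
    rw [inner_add_right, inner_smul_right, inner_self_eq_norm_sq_to_K, Complex.add_im, hreal,
      add_zero]
    norm_cast
    simp [-Complex.ofReal_pow]
  have hle : |z.im| * ‖(v : H)‖ ^ 2 ≤ ‖(v : H)‖ * ‖z • (v : H) + A v‖ := by
    rw [← abs_of_nonneg (sq_nonneg ‖(v : H)‖), ← abs_mul, ← him]
    exact (Complex.abs_im_le_norm _).trans (norm_inner_le_norm _ _)
  rcases (norm_nonneg (v : H)).eq_or_lt with h0 | hpos
  · rw [← h0, mul_zero]
    exact norm_nonneg _
  · refine le_of_mul_le_mul_left ?_ hpos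
    calc ‖(v : H)‖ * (|z.im| * ‖(v : H)‖) = |z.im| * ‖(v : H)‖ ^ 2 := by ring
      _ ≤ _ := hle

/-- Orthogonality to the range puts `u` in the domain of the adjoint, which is `A`, with `A u = -z̄
u`; the lower bound at `z̄` then forces `u = 0`. -/
theorem range_scalarAdd_orthogonal (hA : IsSelfAdjoint A) {z : ℂ} (hz : z.im ≠ 0) (u : H)
    (hu : ∀ v : A.domain, inner ℂ u (z • (v : H) + A v) = 0) : u = 0 := by
  have hw : ∀ v : A.domain, inner ℂ (-(starRingEnd ℂ z) • u) (v : H) = inner ℂ u (A v) := by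
    intro v
    have h := hu v
    rw [inner_add_right, inner_smul_right] at h
    rw [inner_smul_left, map_neg, Complex.conj_conj]
    linear_combination -h
  have hmem : u ∈ A.adjoint.domain := LinearPMap.mem_adjoint_domain_of_exists u ⟨_, hw⟩
  have happ := LinearPMap.adjoint_apply_eq hA.dense_domain ⟨u, hmem⟩ hw
  have hself := LinearPMap.isSelfAdjoint_def.mp hA
  have hmemA : u ∈ A.domain := hself ▸ hmem
  have hAu : A ⟨u, hmemA⟩ = -(starRingEnd ℂ z) • u := by
    rw [← happ]
    exact ((LinearPMap.ext_iff.mp hself).2 (x := u) (hf := hmem) (hg := hmemA)).symm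
  have hb := abs_im_mul_norm_le hA (starRingEnd ℂ z) ⟨u, hmemA⟩
  rw [hAu] at hb
  simp only [neg_smul, add_neg_cancel, norm_zero, Complex.conj_im, abs_neg] at hb
  have : ‖u‖ ≤ 0 := nonpos_of_mul_nonpos_right hb (abs_pos.mpr hz)
  simpa using this

/-- On the graph, a Banach space, `z + A` becomes a bounded operator, so being bounded below gives
closed range, and later the open mapping theorem gives a bounded inverse. -/
theorem graphMap_bijective (hA : IsSelfAdjoint A) {z : ℂ} (hz : z.im ≠ 0) :
    Function.Bijective (graphMap z A) := by
  have hc : CompleteSpace A.graph := hA.isClosed.completeSpace_coe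
  have hpos : 0 < |z.im| := abs_pos.mpr hz
  -- The graph carries the sup norm; the constant dominates both `|Im z|⁻¹`, for `v`, and `1 + ‖z‖
  -- |Im z|⁻¹`, for `A v`.
  have hbound : ∀ p : A.graph, ‖p‖ ≤ (1 + (‖z‖ + 1) * |z.im|⁻¹) * ‖graphMap z A p‖ := by
    intro p
    obtain ⟨v, hv1, hv2⟩ := (LinearPMap.mem_graph_iff A).mp p.2
    have h1 := abs_im_mul_norm_le hA z v
    have hT : graphMap z A p = z • (v : H) + A v := by rw [graphMap_apply, hv1, hv2]
    rw [← hT] at h1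
    have h2 : ‖(v : H)‖ ≤ |z.im|⁻¹ * ‖graphMap z A p‖ := by
      rw [le_inv_mul_iff₀ hpos]
      exact h1
    have h3 : ‖A v‖ ≤ ‖graphMap z A p‖ + ‖z‖ * ‖(v : H)‖ := by
      have : A v = graphMap z A p - z • (v : H) := by rw [hT]; abel
      rw [this, ← norm_smul]
      exact norm_sub_le _ _
    have h4 : 0 ≤ |z.im|⁻¹ * ‖graphMap z A p‖ := by positivity
    have h5 := mul_le_mul_of_nonneg_left h2 (norm_nonneg z)
    have h6 := mul_nonneg (norm_nonneg z) h4
    have h7 := norm_nonneg (graphMap z A p)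
    rw [Submodule.coe_norm, Prod.norm_def, ← hv1, ← hv2]
    exact max_le (by linarith) (by linarith)
  have hanti : AntilipschitzWith (1 + (‖z‖₊ + 1) * ‖z.im‖₊⁻¹) (graphMap z A) :=
    ContinuousLinearMap.antilipschitz_of_bound _ (by simpa using hbound)
  refine ⟨hanti.injective, ?_⟩
  have hclosed : IsClosed ((graphMap z A).range : Set H) := by
    rw [LinearMap.coe_range]
    exact hanti.isClosed_range (graphMap z A).uniformContinuous
  have hcr : CompleteSpace (graphMap z A).range := hclosed.completeSpace_coe
  have htop : (graphMap z A).range = ⊤ := by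
    rw [← Submodule.orthogonal_eq_bot_iff, Submodule.eq_bot_iff]
    intro u hu
    refine range_scalarAdd_orthogonal hA hz u fun v => ?_
    exact Submodule.inner_left_of_mem_orthogonal
      (⟨⟨((v : H), A v), A.mem_graph v⟩, rfl⟩ : z • (v : H) + A v ∈ (graphMap z A).range) hu
  exact LinearMap.range_eq_top.mp htop

theorem exists_isBoundedInverse_scalarAdd (hA : IsSelfAdjoint A) {z : ℂ} (hz : z.im ≠ 0) :
    ∃ R : H →L[ℂ] H, IsBoundedInverse (scalarAdd z A) R := by
  have hc : CompleteSpace A.graph := hA.isClosed.completeSpace_coe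
  have hbij := graphMap_bijective hA hz
  let e : A.graph ≃L[ℂ] H := ContinuousLinearEquiv.ofBijective (graphMap z A)
    (LinearMap.ker_eq_bot.mpr hbij.1) (LinearMap.range_eq_top.mpr hbij.2)
  have he : ∀ p : A.graph, e p = z • (p : H × H).1 + (p : H × H).2 := fun p => rfl
  refine ⟨ContinuousLinearMap.fst ℂ H H ∘L A.graph.subtypeL ∘L (e.symm : H →L[ℂ] A.graph),
    fun u => ?_, fun v => ?_⟩
  · obtain ⟨v, hv1, hv2⟩ := (LinearPMap.mem_graph_iff A).mp (e.symm u).2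
    have hmem : ((e.symm u : A.graph) : H × H).1 ∈ A.domain := hv1 ▸ v.2
    refine ⟨hmem, ?_⟩
    have hv : (⟨((e.symm u : A.graph) : H × H).1, hmem⟩ : A.domain) = v := Subtype.ext hv1.symm
    refine (scalarAdd_apply z A ⟨_, hmem⟩).trans ?_
    rw [hv, hv1, hv2, ← he, e.apply_symm_apply]
  · have : scalarAdd z A v = e ⟨((v : H), A v), A.mem_graph v⟩ := rfl
    rw [this]
    simp

theorem scalarAdd_inner (hA : IsSelfAdjoint A) (z : ℂ) (v w : A.domain) :
    inner ℂ (scalarAdd z A v) (w : H) = inner ℂ (v : H) (scalarAdd (starRingEnd ℂ z) A w) := by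
  rw [scalarAdd_apply, scalarAdd_apply, inner_add_left, inner_add_right, inner_smul_left,
    inner_smul_right, inner_apply_eq_of_isSelfAdjoint hA]

theorem adjoint_isBoundedInverse (hA : IsSelfAdjoint A) {z w : ℂ} (hzw : starRingEnd ℂ z = w)
    {R S : H →L[ℂ] H} (hR : IsBoundedInverse (scalarAdd z A) R)
    (hS : IsBoundedInverse (scalarAdd w A) S) : ContinuousLinearMap.adjoint R = S := by
  symm
  rw [ContinuousLinearMap.eq_adjoint_iff]
  intro x y
  obtain ⟨hx, hx'⟩ := hS.1 x
  obtain ⟨hy, hy'⟩ := hR.1 y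
  have h := scalarAdd_inner hA w ⟨S x, hx⟩ ⟨R y, hy⟩
  have hwz : starRingEnd ℂ w = z := by rw [← hzw, Complex.conj_conj]
  rw [hwz] at h
  calc inner ℂ (S x) y = inner ℂ (S x) (scalarAdd z A ⟨R y, hy⟩) := by rw [hy']
    _ = inner ℂ (scalarAdd w A ⟨S x, hx⟩) (R y) := h.symm
    _ = inner ℂ x (R y) := by rw [hx']

theorem isStarNormal_resolvent (hA : IsSelfAdjoint A) {z : ℂ} (hz : z.im ≠ 0)
    {R : H →L[ℂ] H} (hR : IsBoundedInverse (scalarAdd z A) R) : IsStarNormal R := by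
  obtain ⟨S, hS⟩ := exists_isBoundedInverse_scalarAdd hA (z := starRingEnd ℂ z) (by simpa using hz)
  refine ⟨?_⟩
  rw [ContinuousLinearMap.star_eq_adjoint, adjoint_isBoundedInverse hA rfl hR hS]
  refine commute_resolvent (fun h => hz ?_) hS hR
  exact Complex.conj_eq_iff_im.mp h

end Resolvent

end Resolvante
end

noncomputable section

namespace Resolvante

/-! ### Unitary equivalence from equal Gram matrices. -/

section Gram

variable {ι E F : Type*} [NormedAddCommGroup E] [InnerProductSpace ℂ E]
  [NormedAddCommGroup F] [InnerProductSpace ℂ F]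

theorem norm_linearCombination_eq_of_inner_eq {v : ι → E} {w : ι → F}
    (h : ∀ i j, inner ℂ (v i) (v j) = inner ℂ (w i) (w j)) (a : ι →₀ ℂ) :
    ‖Finsupp.linearCombination ℂ w a‖ = ‖Finsupp.linearCombination ℂ v a‖ := by
  have : inner ℂ (Finsupp.linearCombination ℂ w a) (Finsupp.linearCombination ℂ w a) =
      inner ℂ (Finsupp.linearCombination ℂ v a) (Finsupp.linearCombination ℂ v a) := by
    simp only [Finsupp.linearCombination_apply, Finsupp.sum_inner, Finsupp.inner_sum,
      inner_smul_left, inner_smul_right, h]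
  rw [@norm_eq_sqrt_re_inner ℂ, @norm_eq_sqrt_re_inner ℂ, this]

theorem denseRange_linearCombination [CompleteSpace E] {v : ι → E} (hv : ∀ u, (∀ i, inner ℂ (v i) u = 0) → u = 0) :
    DenseRange (Finsupp.linearCombination ℂ v) := by
  rw [DenseRange, ← LinearMap.coe_range, Submodule.dense_iff_topologicalClosure_eq_top,
    Submodule.topologicalClosure_eq_top_iff, Submodule.eq_bot_iff]
  intro u hu
  refine hv u fun i => Submodule.inner_right_of_mem_orthogonal ?_ hu
  exact ⟨Finsupp.single i 1, by simp⟩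

/-- Two total families with the same Gram matrix are unitarily equivalent. -/
theorem exists_linearIsometryEquiv_of_inner_eq [CompleteSpace E] [CompleteSpace F]
    {v : ι → E} {w : ι → F}
    (h : ∀ i j, inner ℂ (v i) (v j) = inner ℂ (w i) (w j))
    (hv : ∀ u, (∀ i, inner ℂ (v i) u = 0) → u = 0)
    (hw : ∀ u, (∀ i, inner ℂ (w i) u = 0) → u = 0) :
    ∃ U : E ≃ₗᵢ[ℂ] F, ∀ i, U (v i) = w i := by
  let e₁ := Finsupp.linearCombination ℂ v
  let e₂ := Finsupp.linearCombination ℂ w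
  let U : E ≃ₗᵢ[ℂ] F := (LinearEquiv.refl ℂ (ι →₀ ℂ)).extendOfIsometry e₁ e₂
    (denseRange_linearCombination hv) (denseRange_linearCombination hw)
    (norm_linearCombination_eq_of_inner_eq h)
  refine ⟨U, fun i => ?_⟩
  have := LinearEquiv.extendOfIsometry_eq (f := LinearEquiv.refl ℂ (ι →₀ ℂ)) (e₁ := e₁) (e₂ := e₂)
    (denseRange_linearCombination hv) (denseRange_linearCombination hw)
    (norm_linearCombination_eq_of_inner_eq h) (Finsupp.single i 1)
  simpa [e₁, e₂] using this

end Gram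

/-! ### Cyclic decomposition and spectral measures. -/

section Representation

variable {X : Type*} [TopologicalSpace X]
variable {H : Type*} [NormedAddCommGroup H] [InnerProductSpace ℂ H] [CompleteSpace H]

theorem inner_starAlgHom_apply (φ : C(X, ℂ) →⋆ₐ[ℂ] (H →L[ℂ] H)) (f : C(X, ℂ)) (u v : H) :
    inner ℂ (φ f u) v = inner ℂ u (φ (star f) v) := by
  rw [map_star, ContinuousLinearMap.star_eq_adjoint, ContinuousLinearMap.adjoint_inner_right]

theorem starAlgHom_mul_apply (φ : C(X, ℂ) →⋆ₐ[ℂ] (H →L[ℂ] H)) (f g : C(X, ℂ)) (u : H) :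
    φ (f * g) u = φ f (φ g u) := by
  rw [map_mul, mul_apply_eq_comp]

section Cyclic

variable (φ : C(X, ℂ) →⋆ₐ[ℂ] (H →L[ℂ] H)) (d : ℕ → H)

/-- The closed subspace generated by the orbits of `d 0, …, d (n - 1)` under `φ`. -/
def cyclicSpan (n : ℕ) : Submodule ℂ H :=
  (Submodule.span ℂ {u | ∃ m < n, ∃ f, u = φ f (d m)}).topologicalClosure

instance (n : ℕ) : CompleteSpace (cyclicSpan φ d n) :=
  (Submodule.isClosed_topologicalClosure _).completeSpace_coe

theorem apply_mem_cyclicSpan {m n : ℕ} (hmn : m < n) (f : C(X, ℂ)) :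
    φ f (d m) ∈ cyclicSpan φ d n :=
  Submodule.le_topologicalClosure _ (Submodule.subset_span ⟨m, hmn, f, rfl⟩)

theorem cyclicSpan_le {n : ℕ} {S : Submodule ℂ H} (hS : IsClosed (S : Set H))
    (h : ∀ m < n, ∀ f, φ f (d m) ∈ S) : cyclicSpan φ d n ≤ S := by
  refine Submodule.topologicalClosure_minimal _ (Submodule.span_le.mpr ?_) hS
  rintro _ ⟨m, hm, f, rfl⟩
  exact h m hm f

theorem cyclicSpan_mono {m n : ℕ} (hmn : m ≤ n) : cyclicSpan φ d m ≤ cyclicSpan φ d n :=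
  cyclicSpan_le φ d (Submodule.isClosed_topologicalClosure _)
    fun _ hk f => apply_mem_cyclicSpan φ d (hk.trans_le hmn) f

theorem mem_cyclicSpan_apply {n : ℕ} (g : C(X, ℂ)) {u : H} (hu : u ∈ cyclicSpan φ d n) :
    φ g u ∈ cyclicSpan φ d n := by
  have h : cyclicSpan φ d n ≤ (cyclicSpan φ d n).comap (φ g).toLinearMap := by
    refine cyclicSpan_le φ d
      (IsClosed.preimage (φ g).continuous (Submodule.isClosed_topologicalClosure _)) fun m hm f => ?_
    change φ g (φ f (d m)) ∈ cyclicSpan φ d n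
    rw [← starAlgHom_mul_apply]
    exact apply_mem_cyclicSpan φ d hm _
  exact h hu

/-- The component of `d n` orthogonal to the orbits of `d 0, …, d (n - 1)`. -/
def cyclicVector (n : ℕ) : H := d n - (cyclicSpan φ d n).starProjection (d n)

theorem cyclicVector_mem_orthogonal (n : ℕ) : cyclicVector φ d n ∈ (cyclicSpan φ d n)ᗮ :=
  Submodule.sub_starProjection_mem_orthogonal _

theorem self_mem_cyclicSpan (n : ℕ) : d n ∈ cyclicSpan φ d (n + 1) := by
  simpa using apply_mem_cyclicSpan φ d n.lt_succ_self 1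

theorem cyclicVector_mem (n : ℕ) : cyclicVector φ d n ∈ cyclicSpan φ d (n + 1) :=
  Submodule.sub_mem _ (self_mem_cyclicSpan φ d n)
    (cyclicSpan_mono φ d n.le_succ (Submodule.starProjection_apply_mem _ _))

theorem norm_cyclicVector_le (n : ℕ) : ‖cyclicVector φ d n‖ ≤ ‖d n‖ := by
  have h := Submodule.norm_sq_eq_add_norm_sq_starProjection (d n) (cyclicSpan φ d n)
  rw [Submodule.starProjection_orthogonal_val] at h
  refine le_of_sq_le_sq ?_ (norm_nonneg _)
  rw [h]
  exact le_add_of_nonneg_left (sq_nonneg _)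

theorem inner_cyclicVector_of_lt {m n : ℕ} (hmn : m < n) (f g : C(X, ℂ)) :
    inner ℂ (φ f (cyclicVector φ d m)) (φ g (cyclicVector φ d n)) = 0 := by
  -- Moving `g` to the left leaves a vector of the invariant subspace to which `cyclicVector φ d n`
  -- is orthogonal.
  rw [← star_star g, ← inner_starAlgHom_apply]
  refine Submodule.inner_right_of_mem_orthogonal ?_ (cyclicVector_mem_orthogonal φ d n)
  exact mem_cyclicSpan_apply φ d _
    (mem_cyclicSpan_apply φ d _ (cyclicSpan_mono φ d hmn (cyclicVector_mem φ d m)))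

theorem inner_cyclicVector_of_ne {m n : ℕ} (hmn : m ≠ n) (f g : C(X, ℂ)) :
    inner ℂ (φ f (cyclicVector φ d m)) (φ g (cyclicVector φ d n)) = 0 := by
  rcases hmn.lt_or_gt with h | h
  · exact inner_cyclicVector_of_lt φ d h f g
  · rw [← inner_conj_symm, inner_cyclicVector_of_lt φ d h g f, map_zero]

/-- Orthogonalization loses nothing: `d m` is its cyclic vector plus a projection onto the previous
span, which induction already covers. -/
theorem cyclicSpan_le_of_cyclicVector {S : Submodule ℂ H} (hS : IsClosed (S : Set H))
    (h : ∀ n f, φ f (cyclicVector φ d n) ∈ S) (n : ℕ) : cyclicSpan φ d n ≤ S := by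
  induction n with
  | zero => exact cyclicSpan_le φ d hS fun m hm => absurd hm m.not_lt_zero
  | succ n ih =>
    refine cyclicSpan_le φ d hS fun m hm f => ?_
    rcases (Nat.lt_succ_iff_lt_or_eq.mp hm) with hlt | rfl
    · exact ih (apply_mem_cyclicSpan φ d hlt f)
    · have hd : d m = cyclicVector φ d m + (cyclicSpan φ d m).starProjection (d m) := by
        rw [cyclicVector, sub_add_cancel]
      rw [hd, map_add]
      exact S.add_mem (h m f)
        (ih (mem_cyclicSpan_apply φ d f (Submodule.starProjection_apply_mem _ _)))

theorem eq_zero_of_inner_cyclicVector (hd : ∀ u, (∀ n, inner ℂ (d n) u = 0) → u = 0) (u : H)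
    (hu : ∀ n f, inner ℂ (φ f (cyclicVector φ d n)) u = 0) : u = 0 := by
  refine hd u fun n => ?_
  have h := cyclicSpan_le_of_cyclicVector φ d (S := (Submodule.span ℂ {u})ᗮ)
    (Submodule.isClosed_orthogonal _)
    (fun n f => Submodule.mem_orthogonal_singleton_iff_inner_left.mpr (hu n f)) (n + 1)
  exact Submodule.mem_orthogonal_singleton_iff_inner_left.mp (h (self_mem_cyclicSpan φ d n))

end Cyclic

/-- A separable Hilbert space has a total square-summable sequence. -/
theorem exists_summable_total (H : Type*) [NormedAddCommGroup H] [InnerProductSpace ℂ H]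
    [TopologicalSpace.SeparableSpace H] :
    ∃ d : ℕ → H, Summable (fun n => ‖d n‖ ^ 2) ∧ ∀ u, (∀ n, inner ℂ (d n) u = 0) → u = 0 := by
  let e := TopologicalSpace.denseSeq H
  -- Positive weights preserve totality; these also force the norms below `2⁻ⁿ`.
  let c : ℕ → ℝ := fun n => (1 / 2) ^ n * (1 + ‖e n‖)⁻¹
  have hc : ∀ n, 0 < c n := fun n => by positivity
  refine ⟨fun n => (c n : ℂ) • e n, ?_, fun u hu => ?_⟩
  · refine Summable.of_nonneg_of_le (fun n => sq_nonneg _) (fun n => ?_) summable_geometric_two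
    have h1 : ‖(c n : ℂ) • e n‖ ≤ (1 / 2) ^ n := by
      rw [norm_smul, Complex.norm_of_nonneg (hc n).le, mul_assoc]
      refine mul_le_of_le_one_right (by positivity) ?_
      rw [inv_mul_le_one₀ (by positivity)]
      linarith
    have h2 : ((1 : ℝ) / 2) ^ n ≤ 1 := pow_le_one₀ (by norm_num) (by norm_num)
    nlinarith [norm_nonneg ((c n : ℂ) • e n)]
  · have hdense : Dense (Set.range e) := TopologicalSpace.denseRange_denseSeq H
    refine hdense.eq_zero_of_inner_right ℂ ?_
    rintro _ ⟨n, rfl⟩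
    have := hu n
    rw [inner_smul_left] at this
    exact (mul_eq_zero.mp this).resolve_left (by simpa using (hc n).ne')

section SpectralMeasure

variable [CompactSpace X] [T2Space X] [MeasurableSpace X] [BorelSpace X]

/-- The scalar spectral measure of a vector under a representation of `C(X, ℂ)`. -/
theorem exists_spectralMeasure (φ : C(X, ℂ) →⋆ₐ[ℂ] (H →L[ℂ] H)) (u : H) :
    ∃ ν : Measure X, IsFiniteMeasure ν ∧ ν.Regular ∧
      ∀ f : C(X, ℂ), ∫ x, f x ∂ν = inner ℂ u (φ f u) := by
  let ofR : C(X, ℝ) → C(X, ℂ) := fun f => ⟨fun x => (f x : ℂ), by fun_prop⟩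
  have hreal : ∀ f : C(X, ℝ), (inner ℂ u (φ (ofR f) u)).im = 0 := by
    intro f
    have h : star (ofR f) = ofR f := by ext x; simp [ofR]
    have h2 := inner_starAlgHom_apply φ (ofR f) u u
    rw [h, ← inner_conj_symm] at h2
    exact Complex.conj_eq_iff_im.mp h2
  let Λ₀ : CompactlySupportedContinuousMap X ℝ →ₗ[ℝ] ℝ :=
    { toFun := fun f => (inner ℂ u (φ (ofR f.toContinuousMap) u)).re
      map_add' := fun f g => by
        have : ofR (f + g).toContinuousMap = ofR f.toContinuousMap + ofR g.toContinuousMap := by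
          ext x; simp [ofR]
        rw [this, map_add, add_apply, inner_add_right, Complex.add_re]
      map_smul' := fun c f => by
        have : ofR (c • f).toContinuousMap = (c : ℂ) • ofR f.toContinuousMap := by
          ext x; simp [ofR]
        rw [this, map_smul, smul_apply, inner_smul_right]
        simp }
  have hpos : ∀ f, 0 ≤ f → 0 ≤ Λ₀ f := by
    intro f hf
    -- Positivity comes from `f = g²`, so that `⟨u, φ(f) u⟩ = ‖φ(g) u‖²`.
    let g : C(X, ℝ) := ⟨fun x => Real.sqrt (f x), by fun_prop⟩
    have hfg : ofR f.toContinuousMap = star (ofR g) * ofR g := by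
      ext x
      simp only [ofR, g, ContinuousMap.coe_mk, ContinuousMap.mul_apply, ContinuousMap.star_apply,
        Complex.star_def, Complex.conj_ofReal]
      rw [← Complex.ofReal_mul, Real.mul_self_sqrt (hf x)]
      rfl
    change 0 ≤ (inner ℂ u (φ (ofR f.toContinuousMap) u)).re
    rw [hfg, starAlgHom_mul_apply, ← inner_starAlgHom_apply]
    exact inner_self_nonneg (𝕜 := ℂ)
  let Λ : CompactlySupportedContinuousMap X ℝ →ₚ[ℝ] ℝ := PositiveLinearMap.mk₀ Λ₀ hpos
  have hint : ∀ f : C(X, ℝ), ((∫ x, f x ∂(RealRMK.rieszMeasure Λ) : ℝ) : ℂ) =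
      inner ℂ u (φ (ofR f) u) := by
    intro f
    have h := RealRMK.integral_rieszMeasure Λ (CompactlySupportedContinuousMap.continuousMapEquiv f)
    apply Complex.ext
    · rw [Complex.ofReal_re]
      exact h
    · rw [Complex.ofReal_im, hreal]
  refine ⟨RealRMK.rieszMeasure Λ, inferInstance, inferInstance, fun f => ?_⟩
  let fr : C(X, ℝ) := ⟨fun x => (f x).re, by fun_prop⟩
  let fi : C(X, ℝ) := ⟨fun x => (f x).im, by fun_prop⟩
  have hf : f = ofR fr + Complex.I • ofR fi := by
    ext x
    simp [ofR, fr, fi, mul_comm Complex.I]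
  have hI : Integrable (fun x => f x) (RealRMK.rieszMeasure Λ) :=
    f.continuous.integrable_of_hasCompactSupport (HasCompactSupport.of_compactSpace _)
  conv_rhs => rw [hf, map_add, map_smul, add_apply,
    smul_apply, inner_add_right, inner_smul_right, ← hint, ← hint]
  rw [← integral_re_add_im hI, mul_comm Complex.I]
  rfl

end SpectralMeasure

end Representation

end Resolvante
end

noncomputable section

namespace Resolvante

/-! ### Square-integrable functions on a disjoint union of measure spaces. -/

section Slices

variable {X : Type*} [MeasurableSpace X]

/-- The disjoint union of a sequence of measures, as a measure on `ℕ × X`. -/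
def sliceMeasure (ν : ℕ → Measure X) : Measure (ℕ × X) :=
  Measure.sum fun n => (ν n).map (Prod.mk n)

theorem measurableEmbedding_slice (n : ℕ) : MeasurableEmbedding (Prod.mk n : X → ℕ × X) :=
  MeasurableEmbedding.id.prodMk_left n

theorem measurableSet_slice (n : ℕ) : MeasurableSet (({n} : Set ℕ) ×ˢ (Set.univ : Set X)) :=
  (measurableSet_singleton n).prod MeasurableSet.univ

variable (ν : ℕ → Measure X)

theorem sliceMeasure_apply {s : Set (ℕ × X)} (hs : MeasurableSet s) :
    sliceMeasure ν s = ∑' n, ν n (Prod.mk n ⁻¹' s) := by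
  rw [sliceMeasure, Measure.sum_apply _ hs]
  exact tsum_congr fun n => (measurableEmbedding_slice n).map_apply _ _

theorem ae_sliceMeasure_iff {p : ℕ × X → Prop} :
    (∀ᵐ y ∂sliceMeasure ν, p y) ↔ ∀ n, ∀ᵐ x ∂ν n, p (n, x) := by
  rw [sliceMeasure, Measure.ae_sum_iff]
  exact forall_congr' fun n => (measurableEmbedding_slice n).ae_map_iff

theorem sliceMeasure_restrict (n : ℕ) :
    (sliceMeasure ν).restrict ({n} ×ˢ Set.univ) = (ν n).map (Prod.mk n) := by
  ext s hs
  rw [Measure.restrict_apply hs, sliceMeasure_apply ν (hs.inter (measurableSet_slice n)),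
    (measurableEmbedding_slice n).map_apply, tsum_eq_single n]
  · congr 1
    ext x
    simp
  · intro m hm
    have : Prod.mk m ⁻¹' (s ∩ ({n} : Set ℕ) ×ˢ (Set.univ : Set X)) = ∅ := by
      ext x
      simp [hm]
    rw [this, measure_empty]

theorem isFiniteMeasure_sliceMeasure [∀ n, IsFiniteMeasure (ν n)]
    (h : Summable fun n => (ν n).real Set.univ) : IsFiniteMeasure (sliceMeasure ν) := by
  refine ⟨?_⟩
  rw [sliceMeasure_apply ν MeasurableSet.univ]
  have : ∀ n, ν n (Prod.mk n ⁻¹' Set.univ) = ENNReal.ofReal ((ν n).real Set.univ) := fun n => by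
    rw [Set.preimage_univ, ofReal_measureReal]
  simp_rw [this]
  exact h.tsum_ofReal_lt_top

variable {ν}

theorem memLp_slice {h : ℕ × X → ℂ} {p : ℝ≥0∞} (hh : MemLp h p (sliceMeasure ν)) (n : ℕ) :
    MemLp (fun x => h (n, x)) p (ν n) := by
  have h1 := hh.restrict (({n} : Set ℕ) ×ˢ (Set.univ : Set X))
  rw [sliceMeasure_restrict] at h1
  exact (measurableEmbedding_slice n).memLp_map_measure_iff.mp h1

variable [TopologicalSpace X] [BorelSpace X] [CompactSpace X]

theorem memLp_sliceIndicator [IsFiniteMeasure (sliceMeasure ν)] (n : ℕ) (f : C(X, ℂ)) :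
    MemLp ((({n} : Set ℕ) ×ˢ (Set.univ : Set X)).indicator fun y => f y.2) 2 (sliceMeasure ν) := by
  refine MemLp.indicator (measurableSet_slice n) (MemLp.of_bound ?_ ‖f‖ ?_)
  · exact (f.continuous.measurable.comp measurable_snd).aestronglyMeasurable
  · exact Filter.Eventually.of_forall fun y => f.norm_coe_le_norm y.2

/-- The function in `L²` equal to `f` on the `n`-th slice and to zero elsewhere. -/
def sliceLp (ν : ℕ → Measure X) [IsFiniteMeasure (sliceMeasure ν)] (n : ℕ) (f : C(X, ℂ)) :
    Lp ℂ 2 (sliceMeasure ν) :=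
  (memLp_sliceIndicator n f).toLp _

variable [IsFiniteMeasure (sliceMeasure ν)]

theorem sliceLp_ae_self (n : ℕ) (f : C(X, ℂ)) : ∀ᵐ x ∂ν n, sliceLp ν n f (n, x) = f x := by
  filter_upwards [(ae_sliceMeasure_iff ν).mp (memLp_sliceIndicator n f).coeFn_toLp n] with x hx
  exact hx.trans (by simp)

theorem sliceLp_ae_of_ne {m n : ℕ} (hmn : m ≠ n) (f : C(X, ℂ)) :
    ∀ᵐ x ∂ν m, sliceLp ν n f (m, x) = 0 := by
  filter_upwards [(ae_sliceMeasure_iff ν).mp (memLp_sliceIndicator n f).coeFn_toLp m] with x hx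
  exact hx.trans (by simp [hmn])

theorem inner_sliceLp (n : ℕ) (f : C(X, ℂ)) (h : Lp ℂ 2 (sliceMeasure ν)) :
    inner ℂ (sliceLp ν n f) h = ∫ x, inner ℂ (f x) (h (n, x)) ∂ν n := by
  rw [L2.inner_def]
  have h1 : ∀ᵐ y ∂sliceMeasure ν, inner ℂ (sliceLp ν n f y) (h y) =
      (({n} : Set ℕ) ×ˢ (Set.univ : Set X)).indicator (fun y => inner ℂ (f y.2) (h y)) y := by
    filter_upwards [(memLp_sliceIndicator n f).coeFn_toLp] with y hy
    rw [sliceLp, hy]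
    by_cases hmem : y ∈ ({n} : Set ℕ) ×ˢ (Set.univ : Set X)
    · rw [Set.indicator_of_mem hmem, Set.indicator_of_mem hmem]
    · rw [Set.indicator_of_notMem hmem, Set.indicator_of_notMem hmem, inner_zero_left]
  rw [integral_congr_ae h1, integral_indicator (measurableSet_slice n), sliceMeasure_restrict,
    (measurableEmbedding_slice n).integral_map]

theorem inner_sliceLp_self (n : ℕ) (f g : C(X, ℂ)) :
    inner ℂ (sliceLp ν n f) (sliceLp ν n g) = ∫ x, (star f * g) x ∂ν n := by
  rw [inner_sliceLp]
  refine integral_congr_ae ?_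
  filter_upwards [sliceLp_ae_self n g] with x hx
  rw [hx]
  simp [mul_comm]

theorem inner_sliceLp_of_ne {m n : ℕ} (hmn : m ≠ n) (f g : C(X, ℂ)) :
    inner ℂ (sliceLp ν m f) (sliceLp ν n g) = 0 := by
  rw [inner_sliceLp]
  refine integral_eq_zero_of_ae ?_
  filter_upwards [sliceLp_ae_of_ne hmn g] with x hx
  rw [hx, inner_zero_right, Pi.zero_apply]

/-- Continuous functions are dense in `L²` of each slice, by regularity of `ν n`, so `h` vanishes
slice by slice. -/
theorem eq_zero_of_inner_sliceLp [T2Space X] [∀ n, IsFiniteMeasure (ν n)] [∀ n, (ν n).Regular]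
    (h : Lp ℂ 2 (sliceMeasure ν)) (hh : ∀ n f, inner ℂ (sliceLp ν n f) h = 0) : h = 0 := by
  rw [Lp.eq_zero_iff_ae_eq_zero]
  refine (ae_sliceMeasure_iff ν).mpr fun n => ?_
  have hmem := memLp_slice (Lp.memLp h) n
  have hzero : hmem.toLp _ = 0 := by
    refine (ContinuousMap.toLp_denseRange ℂ (ν n) ℂ (p := 2)
      (by norm_num)).eq_zero_of_inner_right ℂ fun f => ?_
    rw [← hh n f, inner_sliceLp, L2.inner_def]
    refine integral_congr_ae ?_
    filter_upwards [ContinuousMap.coeFn_toLp (p := 2) (𝕜 := ℂ) (ν n) f, hmem.coeFn_toLp]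
      with x hx1 hx2
    rw [hx1, hx2]
  filter_upwards [hmem.coeFn_toLp, (Lp.eq_zero_iff_ae_eq_zero).mp hzero] with x hx1 hx2
  rw [← hx1, hx2]
  rfl

end Slices

/-! ### Diagonalization of representations and of normal operators. -/

section Diagonalization

variable {X : Type*} [TopologicalSpace X] [CompactSpace X] [MeasurableSpace X] [BorelSpace X]
variable {H : Type*} [NormedAddCommGroup H] [InnerProductSpace ℂ H] [CompleteSpace H]
  [TopologicalSpace.SeparableSpace H]

theorem memLp_continuousMap_mul {μ : Measure (ℕ × X)} (f : C(X, ℂ)) (h : Lp ℂ 2 μ) :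
    MemLp (fun y => f y.2 * h y) 2 μ := by
  refine (Lp.memLp h).of_le_mul (c := ‖f‖) ?_ (Filter.Eventually.of_forall fun y => ?_)
  · exact (f.continuous.measurable.comp measurable_snd).aestronglyMeasurable.mul
      (Lp.aestronglyMeasurable h)
  · rw [norm_mul]
    exact mul_le_mul_of_nonneg_right (f.norm_coe_le_norm y.2) (norm_nonneg _)

/-- Every representation of `C(X, ℂ)` on a separable Hilbert space is unitarily equivalent to a
representation by multiplication operators. -/
theorem exists_diagonalization [T2Space X] (φ : C(X, ℂ) →⋆ₐ[ℂ] (H →L[ℂ] H)) :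
    ∃ (μ : Measure (ℕ × X)) (_ : IsFiniteMeasure μ) (U : H ≃ₗᵢ[ℂ] Lp ℂ 2 μ),
      ∀ f u, U (φ f u) = (memLp_continuousMap_mul f (U u)).toLp _ := by
  obtain ⟨d, hsum, hd⟩ := exists_summable_total H
  let c := cyclicVector φ d
  choose ν hfin hreg hν using fun n => exists_spectralMeasure φ (c n)
  -- Testing on `f = 1` gives the masses; square-summability of `d` then makes the total mass
  -- finite.
  have hmass : ∀ n, (ν n).real Set.univ = ‖c n‖ ^ 2 := by
    intro n
    have h := hν n 1
    rw [map_one, one_apply_eq_self, inner_self_eq_norm_sq_to_K] at h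
    simp only [ContinuousMap.one_apply, integral_const, Complex.real_smul, mul_one] at h
    refine Complex.ofReal_injective (h.trans ?_)
    push_cast
    rfl
  have hμ : IsFiniteMeasure (sliceMeasure ν) := by
    refine isFiniteMeasure_sliceMeasure ν (hsum.of_nonneg_of_le (fun n => measureReal_nonneg) ?_)
    intro n
    rw [hmass]
    exact pow_le_pow_left₀ (norm_nonneg _) (norm_cyclicVector_le φ d n) 2
  let v : ℕ × C(X, ℂ) → H := fun i => φ i.2 (c i.1)
  let w : ℕ × C(X, ℂ) → Lp ℂ 2 (sliceMeasure ν) := fun i => sliceLp ν i.1 i.2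
  have hgram : ∀ i j, inner ℂ (v i) (v j) = inner ℂ (w i) (w j) := by
    rintro ⟨m, f⟩ ⟨n, g⟩
    change inner ℂ (φ f (c m)) (φ g (c n)) = inner ℂ (sliceLp ν m f) (sliceLp ν n g)
    by_cases hmn : m = n
    · subst hmn
      rw [inner_sliceLp_self, hν, starAlgHom_mul_apply, inner_starAlgHom_apply]
    · rw [inner_sliceLp_of_ne hmn, inner_cyclicVector_of_ne φ d hmn]
  have hw : ∀ h, (∀ i, inner ℂ (w i) h = 0) → h = 0 :=
    fun h hh => eq_zero_of_inner_sliceLp h fun n f => hh (n, f)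
  obtain ⟨U, hU⟩ := exists_linearIsometryEquiv_of_inner_eq hgram
    (fun u hu => eq_zero_of_inner_cyclicVector φ d hd u fun n f => hu (n, f)) hw
  refine ⟨sliceMeasure ν, hμ, U, fun f u => ?_⟩
  -- The intertwining relation is tested against the total family `w`, where `f` moves to the other
  -- side as `star f`.
  rw [← sub_eq_zero]
  refine hw _ ?_
  rintro ⟨n, g⟩
  rw [inner_sub_right, sub_eq_zero]
  have h1 : inner ℂ (w (n, g)) (U (φ f u)) = inner ℂ (w (n, star f * g)) (U u) := by
    rw [← hU, ← hU, U.inner_map_map, U.inner_map_map]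
    change inner ℂ (φ g (c n)) (φ f u) = inner ℂ (φ (star f * g) (c n)) u
    rw [starAlgHom_mul_apply, inner_starAlgHom_apply φ (star f), star_star]
  rw [h1]
  change inner ℂ (sliceLp ν n _) _ = inner ℂ (sliceLp ν n _) _
  rw [inner_sliceLp, inner_sliceLp]
  refine integral_congr_ae ?_
  filter_upwards [(ae_sliceMeasure_iff ν).mp (memLp_continuousMap_mul f (U u)).coeFn_toLp n]
    with x hx
  rw [hx]
  simp only [ContinuousMap.mul_apply, ContinuousMap.star_apply, RCLike.inner_apply, map_mul,
    Complex.star_def, Complex.conj_conj]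
  ring

end Diagonalization

/-- The spectral theorem for bounded normal operators, in multiplication form. -/
theorem exists_mulOp_of_isStarNormal {H : Type*} [NormedAddCommGroup H] [InnerProductSpace ℂ H]
    [CompleteSpace H] [TopologicalSpace.SeparableSpace H] (R : H →L[ℂ] H) (hR : IsStarNormal R) :
    ∃ (Y : Type) (_ : MeasurableSpace Y) (μ : Measure Y) (_ : IsFiniteMeasure μ)
      (U : H ≃ₗᵢ[ℂ] Lp ℂ 2 μ) (F : Y → ℂ), Measurable F ∧ (∃ C : ℝ, ∀ y, ‖F y‖ ≤ C) ∧
      ∀ u, ∃ h : MemLp (fun y => F y * U u y) 2 μ, U (R u) = h.toLp _ := by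
  have hcompact : CompactSpace (spectrum ℂ R) := isCompact_iff_compactSpace.mp (spectrum.isCompact R)
  -- The functional calculus sends the coordinate function to `R`.
  let f : C(spectrum ℂ R, ℂ) := (ContinuousMap.id ℂ).restrict (spectrum ℂ R)
  obtain ⟨μ, hμ, U, hU⟩ := exists_diagonalization (cfcHom hR : C(spectrum ℂ R, ℂ) →⋆ₐ[ℂ] _)
  refine ⟨ℕ × spectrum ℂ R, inferInstance, μ, hμ, U, fun y => f y.2,
    f.continuous.measurable.comp measurable_snd, ⟨‖f‖, fun y => f.norm_coe_le_norm y.2⟩,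
    fun u => ⟨memLp_continuousMap_mul f (U u), ?_⟩⟩
  rw [← hU, cfcHom_id hR]

/-- An injective operator is represented by an almost everywhere nonzero function. -/
theorem ae_ne_zero_of_injective {Y H : Type*} [NormedAddCommGroup H] [InnerProductSpace ℂ H]
    [MeasurableSpace Y] {μ : Measure Y} [IsFiniteMeasure μ] {R : H →L[ℂ] H}
    (hR : Function.Injective R) {U : H ≃ₗᵢ[ℂ] Lp ℂ 2 μ} {F : Y → ℂ} (hF : Measurable F)
    (h : ∀ u, ∃ h : MemLp (fun y => F y * U u y) 2 μ, U (R u) = h.toLp _) :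
    ∀ᵐ y ∂μ, F y ≠ 0 := by
  let s : Set Y := F ⁻¹' {0}
  have hs : MeasurableSet s := hF (measurableSet_singleton 0)
  -- Multiplication by `F` annihilates the indicator of its zero set, which injectivity makes null.
  let e : Lp ℂ 2 μ := indicatorConstLp 2 hs (measure_ne_top μ s) 1
  obtain ⟨hmem, hU⟩ := h (U.symm e)
  have hzero : hmem.toLp _ = 0 := by
    rw [Lp.eq_zero_iff_ae_eq_zero]
    filter_upwards [hmem.coeFn_toLp, (indicatorConstLp_coeFn :
      indicatorConstLp 2 hs (measure_ne_top μ s) (1 : ℂ) =ᵐ[μ] _)] with y hy1 hy2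
    rw [hy1, U.apply_symm_apply, hy2, Pi.zero_apply]
    by_cases hy : y ∈ s
    · rw [show F y = 0 from hy, zero_mul]
    · rw [Set.indicator_of_notMem hy, mul_zero]
  rw [hzero, LinearIsometryEquiv.map_eq_zero_iff] at hU
  have he : e = 0 := by
    have : U.symm e = 0 := hR (hU.trans (map_zero R).symm)
    simpa using this
  filter_upwards [(indicatorConstLp_coeFn :
    indicatorConstLp 2 hs (measure_ne_top μ s) (1 : ℂ) =ᵐ[μ] _),
    (Lp.eq_zero_iff_ae_eq_zero).mp he] with y hy1 hy2 hy3
  have : (e : Y → ℂ) y = s.indicator (fun _ => 1) y := hy1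
  rw [hy2, Set.indicator_of_mem (show y ∈ s from hy3)] at this
  exact zero_ne_one this

end Resolvante
end

/-! ### The spectral representation of the resolvent at `i`. -/

theorem mainTheorem2 {H : Type*} [NormedAddCommGroup H] [InnerProductSpace ℂ H]
    [CompleteSpace H] [TopologicalSpace.SeparableSpace H]
    (A : H →ₗ.[ℂ] H) (hA : IsSelfAdjoint A) :
    ∃ Rp Rm : H →L[ℂ] H,
      Resolvante.IsBoundedInverse (Resolvante.scalarAdd Complex.I A) Rp ∧
      Resolvante.IsBoundedInverse (Resolvante.scalarAdd (-Complex.I) A) Rm ∧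
      ContinuousLinearMap.adjoint Rp = Rm ∧
      ContinuousLinearMap.adjoint Rm = Rp ∧
      IsStarNormal Rp ∧
      IsStarNormal Rm ∧
      ∃ (Y : Type) (_ : MeasurableSpace Y) (μ : Measure Y) (_ : IsFiniteMeasure μ)
        (U : H ≃ₗᵢ[ℂ] Lp ℂ 2 μ) (F : Y → ℂ),
        Measurable F ∧
        (∃ C : ℝ, ∀ y, ‖F y‖ ≤ C) ∧
        (∀ᵐ y ∂μ, F y ≠ 0) ∧
        (U.toLinearEquiv.toLinearMap ∘ₗ Rp.toLinearMap ∘ₗ U.symm.toLinearEquiv.toLinearMap).toPMap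
          ⊤ = Resolvante.mulOp μ F := by
  have hI : Complex.I.im ≠ 0 := by simp
  have hI' : (-Complex.I).im ≠ 0 := by simp
  obtain ⟨Rp, hRp⟩ := Resolvante.exists_isBoundedInverse_scalarAdd hA hI
  obtain ⟨Rm, hRm⟩ := Resolvante.exists_isBoundedInverse_scalarAdd hA hI'
  have hnormal := Resolvante.isStarNormal_resolvent hA hI hRp
  refine ⟨Rp, Rm, hRp, hRm, Resolvante.adjoint_isBoundedInverse hA (by simp) hRp hRm,
    Resolvante.adjoint_isBoundedInverse hA (by simp) hRm hRp, hnormal,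
    Resolvante.isStarNormal_resolvent hA hI' hRm, ?_⟩
  obtain ⟨Y, mY, μ, hμ, U, F, hF, hbound, hU⟩ := Resolvante.exists_mulOp_of_isStarNormal Rp hnormal
  refine ⟨Y, mY, μ, hμ, U, F, hF, hbound,
    Resolvante.ae_ne_zero_of_injective hRp.injective hF hU, ?_⟩
  have hU' : ∀ g : Lp ℂ 2 μ, ∃ h : MemLp (fun y => F y * g y) 2 μ,
      U (Rp (U.symm g)) = h.toLp _ := by
    intro g
    simpa using hU (U.symm g)
  refine LinearPMap.ext ?_ fun g _ _ => ?_
  · refine (Submodule.eq_top_iff'.mpr fun g => ?_).symm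
    exact (hU' g).1
  · exact (hU' g).2
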